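/- Let $R$ be a commutative Noetherian local ring that is Cohen–Macaulay (CM) of Krull dimension $d$, let $I \subsetneq R$ be a proper ideal, and for $a,b\in R$ let $$R(I)_{a,b} = \mathcal R_+ / \bigl((t^2+at+b)R[t]\cap \mathcal R_+\bigr), \qquad \mathcal R_+=\bigoplus_{n\ge 0} I^n t^n\subseteq R[t],$$ be the quotient of the Rees algebra of $I$ by the contraction of the ideal of $R[t]$ generated by $t^2+at+b$. If $I\neq 0$, then for all $a,b\in R$ the ring $R(I)_{a,b}$ is Cohen–Macaulay if and only if $I$ is a Cohen–Macaulay $R$-module of dimension $d$ (that is, a maximal Cohen–Macaulay $R$-module). In particular, whether $R(I)_{a,b}$ is Cohen–Macaulay depends only on $I$: for every proper ideal $I$ and all $a,b,a',b'\in R$, the ring $R(I)_{a,b}$ is Cohen–Macaulay if and only if $R(I)_{a',b'}$ is. Here a Cohen–Macaulay module over a Noetherian local ring is a nonzero finitely generated module whose depth equals its Krull dimension, and a Cohen–Macaulay ring is a Noetherian ring whose localization at each maximal ideal is Cohen–Macaulay as a module over itself. -/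

import Mathlib

open Polynomial

noncomputable section

/-- The ring `R(I)_{a,b}`: the quotient of the Rees algebra `⨁ₙ Iⁿ tⁿ ⊆ R[t]` by the contraction
of the ideal of `R[t]` generated by `t² + a t + b`. -/
abbrev ReesQuotient {R : Type*} [CommRing R] (I : Ideal R) (a b : R) : Type _ :=
  reesAlgebra I ⧸ (Ideal.span {(X ^ 2 + C a * X + C b : R[X])}).comap (reesAlgebra I).val

/-- The depth of a (nonzero, finitely generated) module `M` over a (Noetherian) local ring `R`:
the supremum of the lengths of the `M`-regular sequences contained in the maximal ideal. -/
def localDepth (R : Type*) [CommRing R] [IsLocalRing R]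
    (M : Type*) [AddCommGroup M] [Module R M] : ℕ∞ :=
  ⨆ rs : {rs : List R //
      (∀ r ∈ rs, r ∈ IsLocalRing.maximalIdeal R) ∧ RingTheory.Sequence.IsRegular M rs},
    (rs.1.length : ℕ∞)

/-- A Cohen–Macaulay module over a (Noetherian) local ring: a nonzero finitely generated module
whose depth is equal to its Krull dimension. -/
structure IsCohenMacaulayModule (R : Type*) [CommRing R] [IsLocalRing R]
    (M : Type*) [AddCommGroup M] [Module R M] : Prop where
  finite : Module.Finite R M
  nontrivial : Nontrivial M
  depth_eq_dim : (localDepth R M : WithBot ℕ∞) = Module.supportDim R M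

/-- A Cohen–Macaulay ring: a Noetherian ring whose localization at each maximal ideal is
Cohen–Macaulay as a module over itself. -/
structure IsCohenMacaulayRing (R : Type*) [CommRing R] : Prop where
  noetherian : IsNoetherianRing R
  localization : ∀ (m : Ideal R) [m.IsMaximal],
    IsCohenMacaulayModule (Localization.AtPrime m) (Localization.AtPrime m)

end

/-!
Division with remainder by `t² + a t + b` shows that `R(I)_{a,b}` is `R ⊕ I t` as an `R`-module,
whatever `a` and `b` are. The square of the class of `i t` is a multiple of `i ∈ 𝔪`, so
`R(I)_{a,b}` is a finite local extension of `R`. Depth and dimension of a finite module over a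
finite local extension do not change when it is regarded as an `R`-module; hence `R(I)_{a,b}` is
Cohen–Macaulay if and only if the `R`-module `R ⊕ I` is. As the depth of a direct sum is the
minimum of the depths (by the vanishing of `Ext` groups out of the residue field), while its
dimension is the maximum of the dimensions, this holds if and only if `R` and `I` are
Cohen–Macaulay of the same dimension.
-/

open CategoryTheory Abelian IsLocalRing RingTheory.Sequence
open scoped Pointwise

universe u v w

section Depth

theorem subsingleton_ext_prod_iff {A : Type u} [CommRing A] [Small.{v} A] {M N : Type v}
    [AddCommGroup M] [Module A M] [AddCommGroup N] [Module A N] (X : ModuleCat.{v} A) (i : ℕ) :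
    Subsingleton (Ext X (ModuleCat.of A (M × N)) i) ↔
      Subsingleton (Ext X (ModuleCat.of A M) i) ∧ Subsingleton (Ext X (ModuleCat.of A N) i) := by
  let e : Ext X (ModuleCat.of A (M × N)) i ≃+
      Ext X (ModuleCat.of A M) i × Ext X (ModuleCat.of A N) i :=
    ((extFunctorObj X i).mapIso
      (ModuleCat.biprodIsoProd (.of A M) (.of A N)).symm).addCommGroupIsoToAddEquiv.trans
      Ext.addEquivBiprod
  rw [e.subsingleton_congr]
  refine ⟨fun _ ↦ ⟨?_, ?_⟩, fun ⟨_, _⟩ ↦ inferInstance⟩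
  · exact (Prod.fst_surjective (β := Ext X (.of A N) i)).subsingleton
  · exact (Prod.snd_surjective (α := Ext X (.of A M) i)).subsingleton

variable {A : Type u} [CommRing A] [IsLocalRing A]

theorem localDepth_congr {M : Type v} {N : Type w} [AddCommGroup M] [Module A M] [AddCommGroup N]
    [Module A N] (e : M ≃ₗ[A] N) : localDepth A M = localDepth A N :=
  (Equiv.subtypeEquivRight fun _ ↦ and_congr_right' (e.isRegular_congr _)).iSup_congr fun _ ↦ rfl

variable {M : Type v} [AddCommGroup M] [Module A M] [Module.Finite A M] [Nontrivial M]

theorem localDepth_le_supportDim [IsNoetherianRing A] :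
    (localDepth A M : WithBot ℕ∞) ≤ Module.supportDim A M := by
  obtain ⟨d, hd⟩ := WithBot.ne_bot_iff_exists.1 (Module.supportDim_ne_bot_of_nontrivial A M)
  rw [← hd, WithBot.coe_le_coe]
  refine iSup_le fun ⟨rs, _, hreg⟩ ↦ WithBot.coe_le_coe.1 ?_
  rw [hd, ← Module.supportDim_add_length_eq_supportDim_of_isRegular rs hreg]
  have : Nontrivial (M ⧸ Ideal.ofList rs • (⊤ : Submodule A M)) :=
    Submodule.Quotient.nontrivial_iff.2 hreg.top_ne_smul.symm
  exact le_add_of_nonneg_left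
    (Order.krullDim_nonneg_iff.2 Module.nonempty_support_of_nontrivial.to_subtype)

theorem natCast_le_localDepth_iff_exists {n : ℕ} :
    (n : ℕ∞) ≤ localDepth A M ↔
      ∃ rs : List A, rs.length = n ∧ (∀ r ∈ rs, r ∈ maximalIdeal A) ∧ IsRegular M rs := by
  constructor
  · intro h
    obtain ⟨rs, hmem, hreg, hn⟩ : ∃ rs : List A, (∀ r ∈ rs, r ∈ maximalIdeal A) ∧
        IsRegular M rs ∧ n ≤ rs.length := by
      by_contra! hlt
      obtain _ | n := n
      · exact (hlt [] (by simp) (IsRegular.nil A M)).not_ge (Nat.zero_le _)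
      · have : localDepth A M ≤ n :=
          iSup_le fun rs ↦ Nat.cast_le.2 (Nat.lt_succ_iff.1 (hlt rs.1 rs.2.1 rs.2.2))
        exact (Nat.lt_succ_self n).not_ge (Nat.cast_le.1 (h.trans this))
    have htake : ∀ r ∈ rs.take n, r ∈ maximalIdeal A := fun r hr ↦ hmem r (List.mem_of_mem_take hr)
    have hweak : IsWeaklyRegular M (rs.take n) := by
      rw [← List.take_append_drop n rs, isRegular_iff, isWeaklyRegular_append_iff] at hreg
      exact hreg.1.1
    exact ⟨rs.take n, by simpa using hn, htake,
      IsRegular.of_isWeaklyRegular_of_mem_maximalIdeal M htake hweak⟩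
  · rintro ⟨rs, rfl, hmem, hreg⟩
    exact le_iSup_of_le ⟨rs, hmem, hreg⟩ le_rfl

theorem localDepth_ne_zero_iff :
    localDepth A M ≠ 0 ↔ ∃ x ∈ maximalIdeal A, IsSMulRegular M x := by
  rw [← Order.one_le_iff_ne_zero, ← Nat.cast_one, natCast_le_localDepth_iff_exists]
  constructor
  · rintro ⟨rs, hlen, hmem, hreg⟩
    obtain ⟨x, rfl⟩ := List.length_eq_one_iff.1 hlen
    exact ⟨x, hmem x (List.mem_singleton_self x), ((isRegular_cons_iff M x []).1 hreg).1⟩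
  · rintro ⟨x, hx, hreg⟩
    have : Nontrivial (QuotSMulTop x M) := nontrivial_quotSMulTop_of_mem_maximalIdeal M hx
    exact ⟨[x], rfl, List.forall_mem_singleton.2 hx, .cons hreg (IsRegular.nil A _)⟩

variable [IsNoetherianRing A] [Small.{v} A]

theorem natCast_le_localDepth_iff_subsingleton_ext {n : ℕ} :
    (n : ℕ∞) ≤ localDepth A M ↔ ∀ i < n, Subsingleton
      (Ext (ModuleCat.of A (Shrink.{v} (A ⧸ maximalIdeal A))) (ModuleCat.of A M) i) := by
  have hlt : maximalIdeal A • (⊤ : Submodule A M) < ⊤ :=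
    (Submodule.top_ne_ideal_smul_of_le_jacobson_annihilator
      (maximalIdeal_le_jacobson _)).symm.lt_top
  rw [natCast_le_localDepth_iff_exists]
  exact ((ModuleCat.exists_isRegular_tfae (maximalIdeal A) n (ModuleCat.of A M) hlt).out 1 3).symm

theorem localDepth_quotSMulTop_add_one {x : A} (hx : x ∈ maximalIdeal A)
    (hreg : IsSMulRegular M x) :
    localDepth A (QuotSMulTop x M) + 1 = localDepth A M := by
  have : Nontrivial (QuotSMulTop x M) := nontrivial_quotSMulTop_of_mem_maximalIdeal M hx
  refine ENat.eq_of_forall_natCast_le_iff fun n ↦ ?_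
  obtain _ | n := n
  · simp
  rw [Nat.cast_succ, (ENat.addLECancellable_of_ne_top ENat.one_ne_top).add_le_add_iff_right]
  constructor
  · rw [natCast_le_localDepth_iff_exists, ← Nat.cast_succ, natCast_le_localDepth_iff_exists]
    rintro ⟨rs, rfl, hmem, hrs⟩
    exact ⟨x :: rs, rfl, List.forall_mem_cons.2 ⟨hx, hmem⟩,
      (isRegular_cons_iff M x rs).2 ⟨hreg, hrs⟩⟩
  · rw [natCast_le_localDepth_iff_subsingleton_ext, ← Nat.cast_succ,
      natCast_le_localDepth_iff_subsingleton_ext]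
    intro h i hi
    have hi₀ := AddCommGrpCat.isZero_of_iff_subsingleton.mpr (h i (by omega))
    have hi₁ := AddCommGrpCat.isZero_of_iff_subsingleton.mpr (h (i + 1) (by omega))
    exact AddCommGrpCat.subsingleton_of_isZero <| ShortComplex.Exact.isZero_of_both_zeros
      (Ext.covariant_sequence_exact₃' _
        (IsSMulRegular.smulShortComplex_shortExact (M := ModuleCat.of A M) hreg) i (i + 1) rfl)
      (hi₀.eq_zero_of_src _) (hi₁.eq_zero_of_tgt _)

variable {N : Type v} [AddCommGroup N] [Module A N] [Module.Finite A N] [Nontrivial N]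

theorem localDepth_prod : localDepth A (M × N) = min (localDepth A M) (localDepth A N) :=
  ENat.eq_of_forall_natCast_le_iff fun n ↦ by
    simp only [le_min_iff, natCast_le_localDepth_iff_subsingleton_ext, subsingleton_ext_prod_iff,
      forall_and]

end Depth

section IntegralExtension

variable {A : Type u} {B : Type v} [CommRing A] [CommRing B] [Algebra A B] [Algebra.IsIntegral A B]

theorem ringKrullDim_eq_of_isIntegral [FaithfulSMul A B] : ringKrullDim A = ringKrullDim B := by
  apply le_antisymm
  · refine iSup_le fun l ↦ ?_
    obtain ⟨P, hP, _⟩ := Ideal.nonempty_primesOver (S := B) l.head.asIdeal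
    obtain ⟨L, hL, -⟩ := Ideal.exists_ltSeries_of_hasGoingUp l P
    rw [← hL]
    exact Order.LTSeries.length_le_krullDim L
  · exact Order.krullDim_le_of_strictMono (PrimeSpectrum.comap (algebraMap A B)) fun P Q h ↦
      Ideal.IsIntegral.comap_lt_comap (A := B) (R := A) h

variable {M : Type w} [AddCommGroup M] [Module A M] [Module B M] [IsScalarTower A B M]

theorem supportDim_restrictScalars [Module.Finite A M] :
    Module.supportDim A M = Module.supportDim B M := by
  have := Module.Finite.of_restrictScalars_finite A B M
  have : (Module.annihilator B M).LiesOver (Module.annihilator A M) :=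
    ⟨by ext; simp [Module.mem_annihilator]⟩
  have : Algebra.IsIntegral (A ⧸ Module.annihilator A M) (B ⧸ Module.annihilator B M) :=
    inferInstance
  rw [Module.supportDim_eq_ringKrullDim_quotient_annihilator,
    Module.supportDim_eq_ringKrullDim_quotient_annihilator,
    ringKrullDim_eq_of_isIntegral (B := B ⧸ Module.annihilator B M)]

theorem radical_map_maximalIdeal [IsLocalRing A] [IsLocalRing B] :
    ((maximalIdeal A).map (algebraMap A B)).radical = maximalIdeal B := by
  have hcomap : (maximalIdeal B).comap (algebraMap A B) = maximalIdeal A :=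
    eq_maximalIdeal (Ideal.isMaximal_comap_of_isIntegral_of_isMaximal _)
  refine le_antisymm ?_ ?_
  · rw [(maximalIdeal.isMaximal B).isPrime.isRadical.radical_le_iff]
    exact Ideal.map_le_iff_le_comap.2 hcomap.ge
  · rw [Ideal.radical_eq_sInf]
    refine le_sInf fun P ⟨hP, hPprime⟩ ↦ ?_
    have hmax : (P.comap (algebraMap A B)).IsMaximal := by
      rw [← (maximalIdeal.isMaximal A).eq_of_le (hPprime.comap _).ne_top
        (Ideal.map_le_iff_le_comap.1 hP)]
      exact maximalIdeal.isMaximal A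
    exact (eq_maximalIdeal (Ideal.isMaximal_of_isIntegral_of_isMaximal_comap P hmax)).ge

end IntegralExtension

section RestrictScalars

variable {A : Type u} {B : Type v} [CommRing A] [CommRing B] [Algebra A B]

theorem restrictScalars_algebraMap_smul_top (x : A) (M : Type w) [AddCommGroup M] [Module A M]
    [Module B M] [IsScalarTower A B M] :
    (algebraMap A B x • (⊤ : Submodule B M)).restrictScalars A = x • (⊤ : Submodule A M) := by
  ext m
  simp [Submodule.mem_smul_pointwise_iff_exists, algebraMap_smul]

variable [IsNoetherianRing A]

theorem exists_isSMulRegular_of_mem_radical_map {M : Type w} [AddCommGroup M] [Module A M]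
    [Module B M] [IsScalarTower A B M] [Module.Finite A M] {J : Ideal A} {y : B}
    (hy : y ∈ (J.map (algebraMap A B)).radical) (hreg : IsSMulRegular M y) :
    ∃ x ∈ J, IsSMulRegular M x := by
  -- Elements of `J B`, among them a power of `y`, kill every homomorphism `A ⧸ J → M`.
  obtain ⟨k, hk⟩ := hy
  have hker (f : (A ⧸ J) →ₗ[A] M) :
      J.map (algebraMap A B) ≤ LinearMap.ker (LinearMap.toSpanSingleton B M (f 1)) := by
    refine Ideal.map_le_iff_le_comap.2 fun x hx ↦ ?_
    rw [Ideal.mem_comap, LinearMap.mem_ker, LinearMap.toSpanSingleton_apply, algebraMap_smul,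
      ← map_smul, ← map_one (Ideal.Quotient.mk J), ← Ideal.Quotient.mk_eq_mk,
      ← Submodule.Quotient.mk_smul, (Submodule.Quotient.mk_eq_zero J).2 (by simpa using hx),
      map_zero]
  have : Subsingleton ((A ⧸ J) →ₗ[A] M) := by
    refine subsingleton_of_forall_eq 0 fun f ↦ ?_
    ext
    exact (hreg.pow k).right_eq_zero_of_smul (hker f hk)
  obtain ⟨x, hx, hxreg⟩ := IsSMulRegular.subsingleton_linearMap_iff.1 this
  rw [Ideal.annihilator_quotient] at hx
  exact ⟨x, hx, hxreg⟩

variable [IsLocalRing A] [IsLocalRing B] [IsNoetherianRing B] [Algebra.IsIntegral A B]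
  [Small.{w} A] [Small.{w} B]

theorem localDepth_restrictScalars (M : Type w) [AddCommGroup M] [Module A M] [Module B M]
    [IsScalarTower A B M] [Module.Finite A M] [Nontrivial M] :
    localDepth A M = localDepth B M := by
  have hrad := radical_map_maximalIdeal (A := A) (B := B)
  refine ENat.eq_of_forall_natCast_le_iff fun n ↦ ?_
  induction n generalizing M with
  | zero => simp
  | succ n ih =>
    have := Module.Finite.of_restrictScalars_finite A B M
    by_cases h : ∃ x ∈ maximalIdeal A, IsSMulRegular M x
    · obtain ⟨x, hxA, hreg⟩ := h
      set y := algebraMap A B x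
      have hyB : y ∈ maximalIdeal B := hrad ▸ Ideal.le_radical (Ideal.mem_map_of_mem _ hxA)
      have hyreg : IsSMulRegular M y := (isSMulRegular_algebraMap_iff B).2 hreg
      let e : QuotSMulTop x M ≃ₗ[A] QuotSMulTop y M :=
        Submodule.quotEquivOfEq _ _ (restrictScalars_algebraMap_smul_top x M).symm ≪≫ₗ
          Submodule.Quotient.restrictScalarsEquiv A (y • (⊤ : Submodule B M))
      have : Module.Finite A (QuotSMulTop y M) := .equiv e
      have : Nontrivial (QuotSMulTop y M) := nontrivial_quotSMulTop_of_mem_maximalIdeal M hyB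
      rw [← localDepth_quotSMulTop_add_one hxA hreg, ← localDepth_quotSMulTop_add_one hyB hyreg,
        localDepth_congr e, Nat.cast_succ,
        (ENat.addLECancellable_of_ne_top ENat.one_ne_top).add_le_add_iff_right,
        (ENat.addLECancellable_of_ne_top ENat.one_ne_top).add_le_add_iff_right, ih]
    · have hA : localDepth A M = 0 := not_ne_iff.1 (mt localDepth_ne_zero_iff.1 h)
      have hB : localDepth B M = 0 := not_ne_iff.1 fun hne ↦ by
        obtain ⟨y, hy, hyreg⟩ := localDepth_ne_zero_iff.1 hne
        exact h (exists_isSMulRegular_of_mem_radical_map (hrad ▸ hy) hyreg)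
      rw [hA, hB]

end RestrictScalars

section SupportDim

theorem length_le_krullDim_of_isUpperSet {α : Type*} [Preorder α] {s : Set α} (hs : IsUpperSet s)
    (l : LTSeries α) (hl : l.head ∈ s) : (l.length : WithBot ℕ∞) ≤ Order.krullDim s :=
  Order.LTSeries.length_le_krullDim
    { length := l.length
      toFun i := ⟨l i, hs (l.head_le i) hl⟩
      step := l.step }

theorem krullDim_union_of_isUpperSet {α : Type*} [Preorder α] {s t : Set α} (hs : IsUpperSet s)
    (ht : IsUpperSet t) :
    Order.krullDim ↥(s ∪ t) = max (Order.krullDim s) (Order.krullDim t) := by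
  refine le_antisymm (iSup_le fun l ↦ ?_) (max_le ?_ ?_)
  · let l' : LTSeries α := l.map Subtype.val fun _ _ h ↦ h
    obtain hl | hl : l'.head ∈ s ∪ t := l.head.2
    · exact (length_le_krullDim_of_isUpperSet hs l' hl).trans (le_max_left _ _)
    · exact (length_le_krullDim_of_isUpperSet ht l' hl).trans (le_max_right _ _)
  · exact Order.krullDim_le_of_strictMono (Set.inclusion Set.subset_union_left) fun _ _ h ↦ h
  · exact Order.krullDim_le_of_strictMono (Set.inclusion Set.subset_union_right) fun _ _ h ↦ h

variable {A : Type*} [CommRing A] {M N : Type*} [AddCommGroup M] [Module A M] [AddCommGroup N]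
  [Module A N]

theorem isUpperSet_support : IsUpperSet (Module.support A M) :=
  fun _ _ ↦ Module.mem_support_mono

theorem support_prod : Module.support A (M × N) = Module.support A M ∪ Module.support A N :=
  Module.support_of_exact Function.Exact.inl_snd LinearMap.inl_injective LinearMap.snd_surjective

theorem supportDim_prod :
    Module.supportDim A (M × N) = max (Module.supportDim A M) (Module.supportDim A N) := by
  unfold Module.supportDim
  rw [support_prod, krullDim_union_of_isUpperSet isUpperSet_support isUpperSet_support]

end SupportDim

section CohenMacaulay

variable {A : Type u} [CommRing A] [IsLocalRing A]

theorem IsCohenMacaulayModule.congr {M : Type v} {N : Type w} [AddCommGroup M] [Module A M]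
    [AddCommGroup N] [Module A N] (e : M ≃ₗ[A] N) (h : IsCohenMacaulayModule A M) :
    IsCohenMacaulayModule A N where
  finite := have := h.finite; .equiv e
  nontrivial := have := h.nontrivial; e.symm.toEquiv.nontrivial
  depth_eq_dim := by
    rw [← localDepth_congr e, h.depth_eq_dim, Module.supportDim_eq_of_equiv e]

theorem isCohenMacaulayModule_congr {M : Type v} {N : Type w} [AddCommGroup M] [Module A M]
    [AddCommGroup N] [Module A N] (e : M ≃ₗ[A] N) :
    IsCohenMacaulayModule A M ↔ IsCohenMacaulayModule A N :=
  ⟨.congr e, .congr e.symm⟩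

theorem isCohenMacaulayModule_iff {M : Type v} [AddCommGroup M] [Module A M] [Module.Finite A M]
    [Nontrivial M] :
    IsCohenMacaulayModule A M ↔ (localDepth A M : WithBot ℕ∞) = Module.supportDim A M :=
  ⟨fun h ↦ h.depth_eq_dim, fun h ↦ ⟨‹_›, ‹_›, h⟩⟩

variable [IsNoetherianRing A]

theorem isCohenMacaulayModule_prod_iff [Small.{v} A] {M N : Type v} [AddCommGroup M] [Module A M]
    [Module.Finite A M] [Nontrivial M] [AddCommGroup N] [Module A N] [Module.Finite A N]
    [Nontrivial N] :
    IsCohenMacaulayModule A (M × N) ↔ IsCohenMacaulayModule A M ∧ IsCohenMacaulayModule A N ∧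
      Module.supportDim A M = Module.supportDim A N := by
  have hM := localDepth_le_supportDim (A := A) (M := M)
  have hN := localDepth_le_supportDim (A := A) (M := N)
  simp only [isCohenMacaulayModule_iff, localDepth_prod, supportDim_prod, WithBot.coe_min]
  constructor
  · intro h
    have hle : max (Module.supportDim A M) (Module.supportDim A N) ≤
        min ↑(localDepth A M) ↑(localDepth A N) := h.ge
    rw [max_le_iff, le_min_iff, le_min_iff] at hle
    obtain ⟨⟨hMM, hMN⟩, hNM, hNN⟩ := hle
    exact ⟨hM.antisymm hMM, hN.antisymm hNN, (hMN.trans hN).antisymm (hNM.trans hM)⟩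
  · rintro ⟨hM, hN, h⟩
    rw [hM, hN, h, min_self, max_self]

theorem isCohenMacaulayModule_restrictScalars_iff {B : Type v} [CommRing B] [IsLocalRing B]
    [IsNoetherianRing B] [Algebra A B] [Algebra.IsIntegral A B] [Small.{w} A] [Small.{w} B]
    (M : Type w) [AddCommGroup M] [Module A M] [Module B M] [IsScalarTower A B M]
    [Module.Finite A M] :
    IsCohenMacaulayModule A M ↔ IsCohenMacaulayModule B M := by
  have : Module.Finite B M := .of_restrictScalars_finite A B M
  obtain _ | _ := subsingleton_or_nontrivial M
  · exact iff_of_false (fun h ↦ not_subsingleton_iff_nontrivial.2 h.nontrivial ‹_›)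
      fun h ↦ not_subsingleton_iff_nontrivial.2 h.nontrivial ‹_›
  · rw [isCohenMacaulayModule_iff, isCohenMacaulayModule_iff, localDepth_restrictScalars (B := B),
      supportDim_restrictScalars (B := B)]

theorem isCohenMacaulayRing_iff_isCohenMacaulayModule :
    IsCohenMacaulayRing A ↔ IsCohenMacaulayModule A A := by
  have hmax (m : Ideal A) [hm : m.IsMaximal] : IsCohenMacaulayModule A A ↔
      IsCohenMacaulayModule (Localization.AtPrime m) (Localization.AtPrime m) := by
    obtain rfl := eq_maximalIdeal hm
    let e : A ≃ₐ[A] Localization.AtPrime (maximalIdeal A) :=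
      IsLocalization.atUnits A (maximalIdeal A).primeCompl fun x hx ↦ by
        simpa [Ideal.primeCompl, IsUnit.mem_submonoid_iff] using hx
    have : Module.Finite A (Localization.AtPrime (maximalIdeal A)) := .equiv e.toLinearEquiv
    rw [isCohenMacaulayModule_congr e.toLinearEquiv,
      isCohenMacaulayModule_restrictScalars_iff (B := Localization.AtPrime (maximalIdeal A))]
  exact ⟨fun h ↦ (hmax _).2 (h.localization (maximalIdeal A)), fun h ↦
    ⟨inferInstance, fun m _ ↦ (hmax m).1 h⟩⟩

end CohenMacaulay

section LocalAlgebra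

variable {R : Type u} {S : Type v} [CommRing R] [IsLocalRing R] [CommRing S] [Algebra R S]
  [Nontrivial S]

theorem isLocalRing_of_sub_mem_radical [Algebra.IsIntegral R S]
    (h : ∀ s : S, ∃ r : R,
      s - algebraMap R S r ∈ ((maximalIdeal R).map (algebraMap R S)).radical) :
    IsLocalRing S := by
  have hmem (P : Ideal S) [hP : P.IsMaximal] {s : S} {r : R}
      (hs : s - algebraMap R S r ∈ ((maximalIdeal R).map (algebraMap R S)).radical) :
      s ∈ P ↔ r ∈ maximalIdeal R := by
    have hcomap : P.comap (algebraMap R S) = maximalIdeal R :=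
      eq_maximalIdeal (Ideal.isMaximal_comap_of_isIntegral_of_isMaximal P)
    have hle : ((maximalIdeal R).map (algebraMap R S)).radical ≤ P :=
      hP.isPrime.radical_le_iff.2 (Ideal.map_le_iff_le_comap.2 hcomap.ge)
    rw [← hcomap, Ideal.mem_comap, ← P.add_mem_iff_right (hle hs) (b := algebraMap R S r),
      sub_add_cancel]
  obtain ⟨P, hP⟩ := Ideal.exists_maximal S
  refine .of_unique_max_ideal ⟨P, hP, fun Q (hQ : Q.IsMaximal) ↦ ?_⟩
  ext s
  obtain ⟨r, hr⟩ := h s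
  rw [hmem P hr, hmem Q hr]

theorem isCohenMacaulayRing_iff_of_sub_mem_radical [IsNoetherianRing R] [Module.Finite R S]
    [Small.{v} R]
    (h : ∀ s : S, ∃ r : R,
      s - algebraMap R S r ∈ ((maximalIdeal R).map (algebraMap R S)).radical) :
    IsCohenMacaulayRing S ↔ IsCohenMacaulayModule R S := by
  have : IsNoetherianRing S := .of_finite R S
  have : IsLocalRing S := isLocalRing_of_sub_mem_radical h
  rw [isCohenMacaulayRing_iff_isCohenMacaulayModule,
    isCohenMacaulayModule_restrictScalars_iff (A := R) (B := S)]

end LocalAlgebra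

theorem coeff_modByMonic_mem {R : Type*} [CommRing R] {I : Ideal R} {p f : R[X]} (hp : p.Monic)
    (hdeg : 0 < p.natDegree) (hf : ∀ n ≠ 0, f.coeff n ∈ I) {n : ℕ} (hn : n ≠ 0) :
    (f %ₘ p).coeff n ∈ I := by
  rw [← Ideal.Quotient.eq_zero_iff_mem, ← coeff_map, map_modByMonic _ hp]
  nontriviality R ⧸ I
  have hconst : f.map (Ideal.Quotient.mk I) = C (Ideal.Quotient.mk I (f.coeff 0)) := by
    ext m
    obtain rfl | hm := eq_or_ne m 0
    · simp
    · rw [coeff_map, coeff_C_of_ne_zero hm, Ideal.Quotient.eq_zero_iff_mem.2 (hf m hm)]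
  have hlt : (C (Ideal.Quotient.mk I (f.coeff 0))).degree < (p.map (Ideal.Quotient.mk I)).degree :=
    degree_C_le.trans_lt (natDegree_pos_iff_degree_pos.1 (by rwa [hp.natDegree_map]))
  rw [hconst, (modByMonic_eq_self_iff (hp.map _)).2 hlt, coeff_C_of_ne_zero hn]

namespace ReesQuotient

section Module

variable {R : Type*} [CommRing R] (I : Ideal R) (a b : R)

theorem monic_quadratic : (X ^ 2 + C a * X + C b : R[X]).Monic := by
  monicity!

theorem natDegree_quadratic [Nontrivial R] : (X ^ 2 + C a * X + C b : R[X]).natDegree = 2 := by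
  compute_degree!

/-- The `R`-linear map from `I` to `R(I)_{a,b}` sending `i` to the class of `i t`. -/
noncomputable def ofIdeal : I →ₗ[R] ReesQuotient I a b :=
  (Ideal.Quotient.mkₐ R _).toLinearMap ∘ₗ
    (monomial 1 ∘ₗ I.subtype).codRestrict (Subalgebra.toSubmodule (reesAlgebra I)) fun i ↦
      reesAlgebra.monomial_mem.2 (by simp)

variable {I}

theorem mk_eq_algebraMap_add_ofIdeal_iff {f : reesAlgebra I} {r : R} {i : I} :
    Ideal.Quotient.mk _ f = algebraMap R (ReesQuotient I a b) r + ofIdeal I a b i ↔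
      (X ^ 2 + C a * X + C b : R[X]) ∣ f.1 - (C i.1 * X + C r) := by
  rw [← Ideal.mem_span_singleton, add_comm (C i.1 * X), C_mul_X_eq_monomial (a := i.1)]
  exact Ideal.Quotient.eq

theorem exists_eq_algebraMap_add_ofIdeal [Nontrivial R] (y : ReesQuotient I a b) :
    ∃ r i, y = algebraMap R _ r + ofIdeal I a b i := by
  obtain ⟨f, rfl⟩ := Ideal.Quotient.mk_surjective y
  set p : R[X] := X ^ 2 + C a * X + C b
  have hmonic : p.Monic := monic_quadratic a b
  have hdeg : p.natDegree = 2 := natDegree_quadratic a b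
  have hmem : (f.1 %ₘ p).coeff 1 ∈ I :=
    coeff_modByMonic_mem hmonic (by omega) (fun n hn ↦ Ideal.pow_le_self hn (f.2 n)) one_ne_zero
  have hlin : (f.1 %ₘ p).natDegree ≤ 1 := by
    have := natDegree_modByMonic_lt f.1 hmonic fun h ↦ by simp [h] at hdeg
    omega
  refine ⟨(f.1 %ₘ p).coeff 0, ⟨_, hmem⟩, (mk_eq_algebraMap_add_ofIdeal_iff a b).2 ?_⟩
  rw [← eq_X_add_C_of_natDegree_le_one hlin]
  exact ⟨f.1 /ₘ p, by rw [sub_eq_iff_eq_add', modByMonic_add_div f.1 p]⟩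

theorem algebraMap_add_ofIdeal_eq_zero_iff [Nontrivial R] {r : R} {i : I} :
    algebraMap R (ReesQuotient I a b) r + ofIdeal I a b i = 0 ↔ r = 0 ∧ i = 0 := by
  refine ⟨fun h ↦ ?_, by rintro ⟨rfl, rfl⟩; simp⟩
  have hdvd : (X ^ 2 + C a * X + C b : R[X]) ∣ C i.1 * X + C r := by
    have := (mk_eq_algebraMap_add_ofIdeal_iff a b (f := 0)).1 ((map_zero _).trans h.symm)
    rwa [ZeroMemClass.coe_zero, zero_sub, dvd_neg] at this
  have hzero : C i.1 * X + C r = 0 := by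
    by_contra hne
    refine (monic_quadratic a b).not_dvd_of_natDegree_lt hne ?_ hdvd
    exact natDegree_linear_le.trans_lt (by rw [natDegree_quadratic]; exact one_lt_two)
  have hr := congrArg (coeff · 0) hzero
  have hi := congrArg (coeff · 1) hzero
  exact ⟨by simpa using hr, by simpa [coeff_C] using hi⟩

variable (I)

/-- As an `R`-module, `R(I)_{a,b}` is `R ⊕ I`. -/
noncomputable def prodEquiv [Nontrivial R] : (R × I) ≃ₗ[R] ReesQuotient I a b :=
  LinearEquiv.ofBijective ((Algebra.linearMap R _).coprod (ofIdeal I a b)) <| by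
    refine ⟨(injective_iff_map_eq_zero _).2 fun ⟨r, i⟩ h ↦ ?_, fun y ↦ ?_⟩
    · exact Prod.mk_eq_zero.2 ((algebraMap_add_ofIdeal_eq_zero_iff a b).1 h)
    · obtain ⟨r, i, rfl⟩ := exists_eq_algebraMap_add_ofIdeal a b y
      exact ⟨(r, i), rfl⟩

variable {I}

theorem ofIdeal_sq (i : I) :
    ofIdeal I a b i ^ 2 =
      algebraMap R _ i.1 * (algebraMap R _ (-(b * i.1)) + ofIdeal I a b (-(a • i))) := by
  rw [mul_add, ← map_mul, ← Algebra.smul_def, ← map_smul]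
  refine (mk_eq_algebraMap_add_ofIdeal_iff a b).2 ⟨C (i.1 ^ 2), ?_⟩
  change monomial 1 i.1 ^ 2 - _ = _
  simp only [← C_mul_X_eq_monomial, smul_neg, NegMemClass.coe_neg, SetLike.val_smul, smul_eq_mul,
    map_neg, map_mul, neg_mul, mul_neg, map_pow]
  ring

end Module

section CohenMacaulay

variable {R : Type*} [CommRing R] [IsLocalRing R] {I : Ideal R} (a b : R)

theorem ofIdeal_mem_radical (hI : I ≠ ⊤) (i : I) :
    ofIdeal I a b i ∈ ((maximalIdeal R).map (algebraMap R (ReesQuotient I a b))).radical := by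
  refine ⟨2, ?_⟩
  rw [ofIdeal_sq]
  exact Ideal.mul_mem_right _ _ (Ideal.mem_map_of_mem _ (le_maximalIdeal hI i.2))

theorem isCohenMacaulayRing_iff [IsNoetherianRing R] (hI : I ≠ ⊤) :
    IsCohenMacaulayRing (ReesQuotient I a b) ↔ IsCohenMacaulayModule R (R × I) := by
  have : Module.Finite R (ReesQuotient I a b) := .equiv (prodEquiv I a b)
  have : Nontrivial (ReesQuotient I a b) := (prodEquiv I a b).symm.toEquiv.nontrivial
  rw [isCohenMacaulayModule_congr (prodEquiv I a b)]
  refine isCohenMacaulayRing_iff_of_sub_mem_radical fun y ↦ ?_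
  obtain ⟨r, i, rfl⟩ := exists_eq_algebraMap_add_ofIdeal a b y
  exact ⟨r, by rw [add_sub_cancel_left]; exact ofIdeal_mem_radical a b hI i⟩

end CohenMacaulay

end ReesQuotient

theorem mainTheorem4_general {R : Type*} [CommRing R] [IsLocalRing R] [IsNoetherianRing R]
    (I : Ideal R) (hI : I ≠ ⊤) :
    (I ≠ ⊥ → ∀ a b : R, IsCohenMacaulayRing (ReesQuotient I a b) ↔ IsCohenMacaulayRing R ∧
      IsCohenMacaulayModule R I ∧ Module.supportDim R I = ringKrullDim R) ∧
    (∀ a b a' b' : R, IsCohenMacaulayRing (ReesQuotient I a b) ↔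
      IsCohenMacaulayRing (ReesQuotient I a' b')) := by
  refine ⟨fun hI₀ a b ↦ ?_, fun a b a' b' ↦ ?_⟩
  · have : Nontrivial I := Submodule.nontrivial_iff_ne_bot.2 hI₀
    rw [ReesQuotient.isCohenMacaulayRing_iff _ _ hI, isCohenMacaulayModule_prod_iff,
      isCohenMacaulayRing_iff_isCohenMacaulayModule, Module.supportDim_self_eq_ringKrullDim,
      eq_comm (a := ringKrullDim R)]
  · rw [ReesQuotient.isCohenMacaulayRing_iff _ _ hI, ReesQuotient.isCohenMacaulayRing_iff _ _ hI]

theorem mainTheorem4 {R : Type*} [CommRing R] [IsLocalRing R] (hR : IsCohenMacaulayRing R)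
    (d : ℕ) (hd : ringKrullDim R = d) (I : Ideal R) (hI : I ≠ ⊤) :
    (I ≠ ⊥ → ∀ a b : R, IsCohenMacaulayRing (ReesQuotient I a b) ↔
      IsCohenMacaulayModule R I ∧ Module.supportDim R I = d) ∧
    (∀ a b a' b' : R, IsCohenMacaulayRing (ReesQuotient I a b) ↔
      IsCohenMacaulayRing (ReesQuotient I a' b')) := by
  have := hR.noetherian
  simpa only [hR, hd, true_and] using mainTheorem4_general I hI
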